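/- Let $\mathbb{R}_H^3=\{\mathbf t=(t_1,t_2,t_3)\in\mathbb{R}^3: t_1+t_2+t_3=0\}$, let $\|\mathbf t\|=\max\{|t_1|,|t_2|,|t_3|\}$, and let $\Omega=\{\mathbf t\in\mathbb{R}_H^3: -1\le t_1,\,t_2,\,-t_3<1\}$ be the regular hexagon; integrals over $\Omega$ are taken with respect to the area element $d\mathbf t=dt_1\,dt_2$. For an integer $k\ge 0$ let $$D_k(\mathbf t)=\sum_{\mathbf j\in\mathbb{H}_k} e^{\frac{2\pi i}{3}(j_1t_1+j_2t_2+j_3t_3)},\qquad \mathbb{H}_k=\{\mathbf j\in\mathbb{Z}^3: j_1+j_2+j_3=0,\ -k\le j_1,j_2,j_3\le k\},$$ and, for $\delta>0$ and an integer $n\ge 0$, let $$K_n^{(\delta)}(\mathbf t)=\frac{1}{A_n^{\delta}}\sum_{k=0}^{n}A_{n-k}^{\delta-1}D_k(\mathbf t),\qquad A_m^{\alpha}=\binom{m+\alpha}{\alpha}=\frac{\Gamma(m+\alpha+1)}{\Gamma(\alpha+1)\,\Gamma(m+1)}\quad(\alpha>-1),$$ be the kernel of the Cesàro $(C,\delta)$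 means of hexagonal Fourier series. **Theorem 3.** For every $0<\delta<1$ there is a constant $C>0$, depending only on $\delta$, such that for every integer $n\ge 1$ $$\int_{\Omega}\|\mathbf t\|\,\bigl|K_n^{(\delta)}(\mathbf t)\bigr|\,d\mathbf t\le C\,\frac{\log(n+1)}{(n+1)^{\delta}}.$$ -/

import Mathlib

namespace HexFourier

noncomputable section

/-- The plane of homogeneous coordinates: real triples with `t₁ + t₂ + t₃ = 0`. -/
def plane : Set (Fin 3 → ℝ) := {t | t 0 + t 1 + t 2 = 0}

/-- The point `(t₁, t₂, -t₁ - t₂)` of the plane with first two coordinates `(t₁, t₂)`. -/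
def homog (p : ℝ × ℝ) : Fin 3 → ℝ := ![p.1, p.2, -p.1 - p.2]

theorem homog_mem_plane (p : ℝ × ℝ) : homog p ∈ plane := by
  simp [homog, plane]

theorem measurable_homog : Measurable homog := by
  unfold homog
  refine measurable_pi_lambda _ fun i => ?_
  fin_cases i <;> simp <;> fun_prop

/-- The area element `dt = dt₁ dt₂` of the plane `t₁ + t₂ + t₃ = 0`, as a measure on triples. -/
def planeMeasure : MeasureTheory.Measure (Fin 3 → ℝ) :=
  MeasureTheory.Measure.map homog (MeasureTheory.volume : MeasureTheory.Measure (ℝ × ℝ))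

/-- The regular hexagon `-1 ≤ t₁, t₂, -t₃ < 1` in homogeneous coordinates. -/
def Omega : Set (Fin 3 → ℝ) :=
  {t | t ∈ plane ∧ (-1 ≤ t 0 ∧ t 0 < 1) ∧ (-1 ≤ t 1 ∧ t 1 < 1) ∧ (-1 ≤ -t 2 ∧ -t 2 < 1)}

/-- The norm `max {|t₁|, |t₂|, |t₃|}`. -/
def hexNorm (t : Fin 3 → ℝ) : ℝ := max |t 0| (max |t 1| |t 2|)

/-- Integer triples with zero sum and all entries between `-n` and `n`. -/
def hexIndex (n : ℕ) : Finset (Fin 3 → ℤ) :=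
  (Fintype.piFinset fun _ : Fin 3 => Finset.Icc (-(n : ℤ)) (n : ℤ)).filter
    fun j => j 0 + j 1 + j 2 = 0

/-- The exponential `exp ((2πi/3) ⟨j, t⟩)`. -/
def phi (j : Fin 3 → ℤ) (t : Fin 3 → ℝ) : ℂ :=
  Complex.exp (2 * (Real.pi : ℂ) * Complex.I / 3 * ((∑ i, (j i : ℝ) * t i : ℝ) : ℂ))

/-- The hexagonal Dirichlet kernel. -/
def dirichletKernel (n : ℕ) (t : Fin 3 → ℝ) : ℂ := ∑ j ∈ hexIndex n, phi j t

/-- The binomial coefficient with real entries,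
`Γ(x + 1) / (Γ(y + 1) Γ(x - y + 1))`. -/
def realBinom (x y : ℝ) : ℝ :=
  Real.Gamma (x + 1) / (Real.Gamma (y + 1) * Real.Gamma (x - y + 1))

/-- The Cesàro number `A_n^δ`, the binomial coefficient of `n + δ` over `δ`. -/
def cesaroNumber (δ : ℝ) (n : ℕ) : ℝ := realBinom ((n : ℝ) + δ) δ

/-- The kernel `K_n^{(δ)}` of the Cesàro `(C, δ)` means of hexagonal Fourier series. -/
def cesaroKernel (δ : ℝ) (n : ℕ) (t : Fin 3 → ℝ) : ℂ :=
  (1 / (cesaroNumber δ n : ℂ)) *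
    ∑ k ∈ Finset.range (n + 1), (cesaroNumber (δ - 1) (n - k) : ℂ) * dirichletKernel k t

end

end HexFourier

namespace HexFourier

/-! Write `N = n + 1`. In the angles `s_j = π (t_k - t_l) / 3`, which sum to zero, the Dirichlet
kernel has a closed form, and averaging gives `K · sin s₁ sin s₂ sin s₃ = -(1 / (2 A_n^δ)) Σ G(s_j)
sin s_j` with `G = cesaroCos δ n` (`cesaroKernel_mul_sin`). Summation by parts against the
decreasing weights `A_m^{δ-1}` gives `|G(s)| ≲ |sin s|^{-δ}`, while `A_n^δ ≥ N^δ`.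

Let `x` be the angle of least modulus and `R` the largest modulus. On the hexagon all angles are at
most `2π/3` in modulus, so sines are comparable to angles; the other two angles are at least `R/2`
in modulus, and the product of sines has order `|x| R²`. The target is `R |K| ≲ N^{-δ} R^{-δ} / (|x|
+ 1/N)`. If `|x| ≥ 1/N`, bounding the three numerator terms separately by `R^{1-δ}` suffices. If
`|x| < 1/N ≤ R`, the numerator must gain a factor `|x|`: the other angles satisfy `y ≈ -z`, `G` is
even and `sin` odd, so their terms nearly cancel (`abs_numerator_le`). If `R < 1/N`, the bound `|K|
≤ 4 N²` suffices.

Since `R` dominates every coordinate, `R^{-δ}` may be replaced by a power of one fixed coordinate.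
Integrating `1 / (|x| + 1/N)` in the other coordinate produces `log N`, and `|a|^{-δ}` is integrable
because `δ < 1`. -/

/-! ### Cesàro numbers: recursion, size, sums -/

theorem cesaroNumber_eq (δ : ℝ) (n : ℕ) :
    cesaroNumber δ n = Real.Gamma (n + δ + 1) / (Real.Gamma (δ + 1) * Real.Gamma (n + 1)) := by
  simp [cesaroNumber, realBinom]

theorem cesaroNumber_zero {δ : ℝ} (hδ : -1 < δ) : cesaroNumber δ 0 = 1 := by
  have : Real.Gamma (δ + 1) ≠ 0 := (Real.Gamma_pos_of_pos (by linarith)).ne'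
  simp [cesaroNumber_eq, this]

theorem cesaroNumber_succ {δ : ℝ} (hδ : -1 < δ) (n : ℕ) :
    cesaroNumber δ (n + 1) = cesaroNumber δ n * ((n + 1 + δ) / (n + 1)) := by
  have hn : (0 : ℝ) ≤ n := n.cast_nonneg
  have h1 : Real.Gamma (δ + 1) ≠ 0 := (Real.Gamma_pos_of_pos (by linarith)).ne'
  have h2 : Real.Gamma (n + 1 : ℝ) ≠ 0 := (Real.Gamma_pos_of_pos (by linarith)).ne'
  have h3 : (n + 1 : ℝ) ≠ 0 := by positivity
  have h4 : Real.Gamma (n + 1 + 1 : ℝ) = (n + 1) * Real.Gamma (n + 1) := Real.Gamma_add_one h3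
  have h5 : Real.Gamma (n + 1 + δ + 1 : ℝ) = (n + 1 + δ) * Real.Gamma (n + δ + 1) := by
    rw [Real.Gamma_add_one (by linarith)]; congr 2; ring
  rw [cesaroNumber_eq, cesaroNumber_eq]
  push_cast
  rw [h4, h5]
  field_simp

theorem cesaroNumber_pos {δ : ℝ} (hδ : -1 < δ) (n : ℕ) : 0 < cesaroNumber δ n := by
  have hn : (0 : ℝ) ≤ n := n.cast_nonneg
  rw [cesaroNumber_eq]
  have h1 := Real.Gamma_pos_of_pos (show 0 < δ + 1 by linarith)
  have h2 := Real.Gamma_pos_of_pos (show 0 < (n : ℝ) + 1 by linarith)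
  have h3 := Real.Gamma_pos_of_pos (show 0 < (n : ℝ) + δ + 1 by linarith)
  positivity

/-- Consecutive ratios are `1 + δ/(n+1)`, and Bernoulli's inequality for exponents in `[0, 1]`
bounds the ratio of the powers by the same number. -/
theorem rpow_le_cesaroNumber {δ : ℝ} (h0 : 0 < δ) (h1 : δ < 1) (n : ℕ) :
    ((n : ℝ) + 1) ^ δ ≤ cesaroNumber δ n := by
  induction n with
  | zero => simp [cesaroNumber_zero (show -1 < δ by linarith)]
  | succ n ih =>
    have hp : (0 : ℝ) < n + 1 := by positivity
    rw [cesaroNumber_succ (by linarith)]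
    have hb : (1 + 1 / ((n : ℝ) + 1)) ^ δ ≤ 1 + δ * (1 / ((n : ℝ) + 1)) :=
      rpow_one_add_le_one_add_mul_self (by have := one_div_pos.2 hp; linarith) h0.le h1.le
    have e1 : ((n + 1 : ℕ) : ℝ) + 1 = (n + 1) * (1 + 1 / ((n : ℝ) + 1)) := by
      push_cast; field_simp
    have e2 : ((n : ℝ) + 1 + δ) / (n + 1) = 1 + δ * (1 / ((n : ℝ) + 1)) := by
      field_simp
    rw [e1, e2, Real.mul_rpow hp.le (by positivity)]
    exact mul_le_mul ih hb (by positivity) (cesaroNumber_pos (by linarith) n).le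

/-- With `h = (1-δ)/(n+1)` the ratio is `1 - h ≤ 1/(1 + h)`, and Bernoulli with exponent `1 - δ`
compares this with the ratio of the powers. -/
theorem cesaroNumber_sub_one_le {δ : ℝ} (h0 : 0 < δ) (h1 : δ < 1) (n : ℕ) :
    cesaroNumber (δ - 1) n ≤ ((n : ℝ) + 1) ^ (δ - 1) := by
  induction n with
  | zero => simp [cesaroNumber_zero (show -1 < δ - 1 by linarith)]
  | succ n ih =>
    have hp : (0 : ℝ) < n + 1 := by positivity
    have hx : 0 < 1 / ((n : ℝ) + 1) := one_div_pos.2 hp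
    rw [cesaroNumber_succ (by linarith)]
    have hb : (1 + 1 / ((n : ℝ) + 1)) ^ (1 - δ) ≤ 1 + (1 - δ) * (1 / ((n : ℝ) + 1)) :=
      rpow_one_add_le_one_add_mul_self (by linarith) (by linarith) (by linarith)
    have e1 : ((n + 1 : ℕ) : ℝ) + 1 = (n + 1) * (1 + 1 / ((n : ℝ) + 1)) := by
      push_cast; field_simp
    have e2 : ((n : ℝ) + 1 + (δ - 1)) / (n + 1) = 1 - (1 - δ) * (1 / ((n : ℝ) + 1)) := by
      field_simp; ring
    rw [e1, e2, Real.mul_rpow hp.le (by positivity)]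
    have hq : 0 < (1 + 1 / ((n : ℝ) + 1)) ^ (1 - δ) := by positivity
    have e3 : (1 + 1 / ((n : ℝ) + 1)) ^ (δ - 1) = ((1 + 1 / ((n : ℝ) + 1)) ^ (1 - δ))⁻¹ := by
      rw [← Real.rpow_neg (by positivity)]; congr 1; ring
    have hx1 : 1 / ((n : ℝ) + 1) ≤ 1 := by
      rw [div_le_one hp]; linarith [n.cast_nonneg (α := ℝ)]
    have h5 : 0 ≤ 1 - (1 - δ) * (1 / ((n : ℝ) + 1)) := by nlinarith
    refine mul_le_mul ih ?_ h5 (by positivity)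
    rw [e3, ← one_div, le_div_iff₀ hq]
    nlinarith [mul_le_mul_of_nonneg_left hb h5, sq_nonneg ((1 - δ) * (1 / ((n : ℝ) + 1)))]

theorem antitone_cesaroNumber_sub_one {δ : ℝ} (h0 : 0 < δ) (h1 : δ < 1) :
    Antitone (cesaroNumber (δ - 1)) := by
  refine antitone_nat_of_succ_le fun n => ?_
  rw [cesaroNumber_succ (by linarith)]
  have hp : (0 : ℝ) < n + 1 := by positivity
  refine mul_le_of_le_one_right (cesaroNumber_pos (by linarith) n).le ?_
  rw [div_le_one hp]; linarith

theorem sum_cesaroNumber_sub_one {δ : ℝ} (h0 : 0 < δ) (n : ℕ) :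
    ∑ m ∈ Finset.range (n + 1), cesaroNumber (δ - 1) m =
      cesaroNumber (δ - 1) n * ((n + δ) / δ) := by
  induction n with
  | zero => simp [h0.ne']
  | succ n ih =>
    have hp : (0 : ℝ) < n + 1 := by positivity
    rw [Finset.sum_range_succ, ih, cesaroNumber_succ (by linarith)]
    push_cast
    field_simp
    ring

theorem sum_cesaroNumber_sub_one_eq {δ : ℝ} (h0 : 0 < δ) (n : ℕ) :
    ∑ m ∈ Finset.range (n + 1), cesaroNumber (δ - 1) m = cesaroNumber δ n := by
  induction n with
  | zero =>
    simp [cesaroNumber_zero (show -1 < δ by linarith),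
      cesaroNumber_zero (show -1 < δ - 1 by linarith)]
  | succ n ih =>
    have hp : (0 : ℝ) < n + 1 := by positivity
    have hs := sum_cesaroNumber_sub_one h0 n
    rw [Finset.sum_range_succ, ih, cesaroNumber_succ (by linarith), cesaroNumber_succ (by linarith),
      ← ih, hs]
    field_simp
    ring

theorem sum_cesaroNumber_sub_one_le {δ : ℝ} (h0 : 0 < δ) (h1 : δ < 1) (n : ℕ) :
    ∑ m ∈ Finset.range n, cesaroNumber (δ - 1) m ≤ (n : ℝ) ^ δ / δ := by
  cases n with
  | zero => simp [h0.ne']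
  | succ n =>
    have hp : (0 : ℝ) < n + 1 := by positivity
    rw [sum_cesaroNumber_sub_one h0]
    push_cast
    calc cesaroNumber (δ - 1) n * ((n + δ) / δ)
        ≤ ((n : ℝ) + 1) ^ (δ - 1) * ((n + 1) / δ) := by
          refine mul_le_mul (cesaroNumber_sub_one_le h0 h1 n) ?_ (by positivity) (by positivity)
          gcongr
      _ = ((n : ℝ) + 1) ^ δ / δ := by
          rw [Real.rpow_sub_one hp.ne']; field_simp

/-! ### Cesàro-weighted cosine sums -/

/-- Summation by parts with a multiplier of bounded variation. -/
theorem abs_sum_mul_le (c z : ℕ → ℝ) (B V W : ℝ) (n : ℕ)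
    (hz : ∀ j ≤ n + 1, |∑ k ∈ Finset.range j, z k| ≤ B) (hc : |c n| ≤ W)
    (hV : ∑ k ∈ Finset.range n, |c (k + 1) - c k| ≤ V) :
    |∑ k ∈ Finset.range (n + 1), c k * z k| ≤ (W + V) * B := by
  have hB : 0 ≤ B := (abs_nonneg _).trans (hz 0 (Nat.zero_le _))
  have h := Finset.sum_range_by_parts c z (n + 1)
  simp only [smul_eq_mul, Nat.add_sub_cancel] at h
  rw [h]
  refine (abs_sub _ _).trans ?_
  rw [add_mul, abs_mul]
  refine add_le_add (mul_le_mul hc (hz _ le_rfl) (abs_nonneg _) ((abs_nonneg _).trans hc)) ?_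
  refine (Finset.abs_sum_le_sum_abs _ _).trans ?_
  refine le_trans ?_ (mul_le_mul_of_nonneg_right hV hB)
  rw [Finset.sum_mul]
  refine Finset.sum_le_sum fun k hk => ?_
  rw [abs_mul]
  exact mul_le_mul_of_nonneg_left (hz _ (by have := Finset.mem_range.1 hk; omega)) (abs_nonneg _)

/-- Multiplication by `2 sin x` makes the sum telescope. The free phase `φ` lets the bound apply to
tails and to sine sums. -/
theorem abs_sum_cos_le (φ x : ℝ) (hx : Real.sin x ≠ 0) (n : ℕ) :
    |∑ m ∈ Finset.range n, Real.cos (φ - 2 * m * x)| ≤ 1 / |Real.sin x| := by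
  have h : ∀ n : ℕ, 2 * Real.sin x * ∑ m ∈ Finset.range n, Real.cos (φ - 2 * m * x) =
      Real.sin (φ + x) - Real.sin (φ + x - 2 * n * x) := by
    intro n
    induction n with
    | zero => simp
    | succ n ih =>
      rw [Finset.sum_range_succ, mul_add, ih]
      have e1 : φ + x - 2 * n * x = (φ - 2 * n * x) + x := by ring
      have e2 : φ + x - 2 * ((n + 1 : ℕ) : ℝ) * x = (φ - 2 * n * x) - x := by push_cast; ring
      rw [e1, e2, Real.sin_add (φ - 2 * n * x), Real.sin_sub (φ - 2 * n * x)]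
      ring
  have h2 := congrArg abs (h n)
  rw [abs_mul, abs_mul, abs_two] at h2
  have h3 := abs_sub (Real.sin (φ + x)) (Real.sin (φ + x - 2 * n * x))
  have h4 := Real.abs_sin_le_one (φ + x)
  have h5 := Real.abs_sin_le_one (φ + x - 2 * n * x)
  rw [le_div_iff₀ (abs_pos.2 hx)]
  nlinarith

/-- The sum is cut at `M ≈ 1/|sin x|`. The head is bounded by the sum of the weights, of order
`M^δ`; the tail, by parts with decreasing weights, by `A_M^{δ-1} / |sin x|`. Both are of order `|sin
x|^{-δ}`. -/
theorem abs_sum_cesaroNumber_mul_cos_le {δ : ℝ} (h0 : 0 < δ) (h1 : δ < 1) (φ x : ℝ)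
    (hx : Real.sin x ≠ 0) (n : ℕ) :
    |∑ m ∈ Finset.range n, cesaroNumber (δ - 1) m * Real.cos (φ - 2 * m * x)| ≤
      (2 / δ + 1) * |Real.sin x| ^ (-δ) := by
  set s := |Real.sin x| with hs
  have hs0 : 0 < s := abs_pos.2 hx
  have hs1 : s ≤ 1 := Real.abs_sin_le_one x
  set M := ⌈1 / s⌉₊ with hM
  have hM1 : 1 / s ≤ M := Nat.le_ceil _
  have hs1' : 1 ≤ 1 / s := by rw [le_div_iff₀ hs0]; linarith
  have hM2 : (M : ℝ) ≤ 2 * (1 / s) := by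
    have := Nat.ceil_lt_add_one (show 0 ≤ 1 / s by positivity)
    linarith
  have hpow : s ^ (-δ) = (1 / s) ^ δ := by
    rw [Real.rpow_neg hs0.le, one_div, Real.inv_rpow hs0.le]
  have hspos : 0 < s ^ (-δ) := by positivity
  have head : ∀ j ≤ M,
      |∑ m ∈ Finset.range j, cesaroNumber (δ - 1) m * Real.cos (φ - 2 * m * x)| ≤
        2 / δ * s ^ (-δ) := by
    intro j hj
    calc _ ≤ ∑ m ∈ Finset.range j, |cesaroNumber (δ - 1) m * Real.cos (φ - 2 * m * x)| :=
          Finset.abs_sum_le_sum_abs _ _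
      _ ≤ ∑ m ∈ Finset.range j, cesaroNumber (δ - 1) m := by
          refine Finset.sum_le_sum fun m _ => ?_
          have hp := cesaroNumber_pos (show -1 < δ - 1 by linarith) m
          rw [abs_mul, abs_of_pos hp]
          exact mul_le_of_le_one_right hp.le (Real.abs_cos_le_one _)
      _ ≤ (j : ℝ) ^ δ / δ := sum_cesaroNumber_sub_one_le h0 h1 j
      _ ≤ (2 * (1 / s)) ^ δ / δ := by
          have : (j : ℝ) ≤ M := by exact_mod_cast hj
          gcongr
          linarith
      _ = 2 ^ δ / δ * s ^ (-δ) := by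
          rw [Real.mul_rpow (by norm_num) (by positivity), hpow]; ring
      _ ≤ 2 / δ * s ^ (-δ) := by
          have : (2 : ℝ) ^ δ ≤ 2 := by
            simpa using Real.rpow_le_rpow_of_exponent_le (show (1 : ℝ) ≤ 2 by norm_num) h1.le
          gcongr
  rcases le_or_gt n M with hn | hn
  · refine (head n hn).trans ?_
    rw [add_mul]; linarith
  · obtain ⟨j, rfl⟩ : ∃ j, n = M + (j + 1) := ⟨n - M - 1, by omega⟩
    rw [Finset.sum_range_add, add_mul, one_mul]
    refine (abs_add_le _ _).trans (add_le_add (head M le_rfl) ?_)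
    have anti := antitone_cesaroNumber_sub_one h0 h1
    -- The total variation telescopes to the difference of the end weights; adding the last weight
    -- leaves only the first one.
    have key := abs_sum_mul_le (fun k => cesaroNumber (δ - 1) (M + k))
      (fun k => Real.cos ((φ - 2 * M * x) - 2 * k * x)) (1 / s)
      (cesaroNumber (δ - 1) M - cesaroNumber (δ - 1) (M + j)) (cesaroNumber (δ - 1) (M + j)) j
      (fun i _ => abs_sum_cos_le _ x hx i)
      (abs_of_pos (cesaroNumber_pos (by linarith) _)).le
      (by
        have : ∀ k, |cesaroNumber (δ - 1) (M + (k + 1)) - cesaroNumber (δ - 1) (M + k)| =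
            cesaroNumber (δ - 1) (M + k) - cesaroNumber (δ - 1) (M + (k + 1)) := by
          intro k
          rw [abs_sub_comm, abs_of_nonneg (sub_nonneg.2 (anti (by omega)))]
        simp only [this]
        rw [Finset.sum_range_sub' (fun k => cesaroNumber (δ - 1) (M + k))]
        simp)
    have e : ∀ k : ℕ, φ - 2 * ((M + k : ℕ) : ℝ) * x = (φ - 2 * M * x) - 2 * k * x := by
      intro k; push_cast; ring
    simp only [e]
    refine key.trans ?_
    have hM0 : (0 : ℝ) < M := lt_of_lt_of_le (by positivity) hM1
    calc _ = cesaroNumber (δ - 1) M * (1 / s) := by ring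
      _ ≤ (1 / s) ^ (δ - 1) * (1 / s) := by
          gcongr
          refine (cesaroNumber_sub_one_le h0 h1 M).trans ?_
          exact Real.rpow_le_rpow_of_nonpos (by positivity) (by linarith) (by linarith)
      _ = s ^ (-δ) := by
          rw [hpow, Real.rpow_sub_one (by positivity)]; field_simp

/-- The Cesàro-weighted sum of the cosines `cos ((2k + 1) s)`. -/
noncomputable def cesaroCos (δ : ℝ) (n : ℕ) (s : ℝ) : ℝ :=
  ∑ m ∈ Finset.range (n + 1), cesaroNumber (δ - 1) m * Real.cos ((2 * n + 1) * s - 2 * m * s)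

theorem cesaroCos_eq_sum (δ : ℝ) (n : ℕ) (s : ℝ) :
    cesaroCos δ n s =
      ∑ k ∈ Finset.range (n + 1), cesaroNumber (δ - 1) (n - k) * Real.cos ((2 * k + 1) * s) := by
  rw [cesaroCos, ← Finset.sum_range_reflect]
  refine Finset.sum_congr rfl fun k hk => ?_
  have hk' : k ≤ n := by have := Finset.mem_range.1 hk; omega
  have e : n + 1 - 1 - k = n - k := by omega
  rw [e, Nat.cast_sub hk']
  congr 2
  ring

theorem cesaroCos_neg (δ : ℝ) (n : ℕ) (s : ℝ) : cesaroCos δ n (-s) = cesaroCos δ n s := by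
  rw [cesaroCos, cesaroCos]
  refine Finset.sum_congr rfl fun m _ => ?_
  rw [← Real.cos_neg]
  congr 2
  ring

theorem abs_cesaroCos_le_cesaroNumber {δ : ℝ} (h0 : 0 < δ) (n : ℕ) (s : ℝ) :
    |cesaroCos δ n s| ≤ cesaroNumber δ n := by
  rw [← sum_cesaroNumber_sub_one_eq h0]
  refine (Finset.abs_sum_le_sum_abs _ _).trans (Finset.sum_le_sum fun m _ => ?_)
  have hp := cesaroNumber_pos (show -1 < δ - 1 by linarith) m
  rw [abs_mul, abs_of_pos hp]
  exact mul_le_of_le_one_right hp.le (Real.abs_cos_le_one _)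

theorem abs_cesaroCos_le {δ : ℝ} (h0 : 0 < δ) (h1 : δ < 1) (n : ℕ) {s : ℝ}
    (hs : Real.sin s ≠ 0) :
    |cesaroCos δ n s| ≤ (2 / δ + 1) * |Real.sin s| ^ (-δ) :=
  abs_sum_cesaroNumber_mul_cos_le h0 h1 _ s hs _

/-- The difference of cosines is `-2` times a sine at the half-difference and a sine at the
midpoint. The first varies slowly in `m` and is the multiplier in a summation by parts; the second
carries the oscillation. -/
theorem abs_cesaroCos_sub_le {δ : ℝ} (h0 : 0 < δ) (h1 : δ < 1) (n : ℕ) {x y : ℝ}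
    (hs : Real.sin ((x + y) / 2) ≠ 0) :
    |cesaroCos δ n x - cesaroCos δ n y| ≤
      2 * (n + 1) * |x - y| * ((2 / δ + 1) * |Real.sin ((x + y) / 2)| ^ (-δ)) := by
  set w := (x + y) / 2 with hw
  set u := (x - y) / 2 with hu
  have habs : |u| = |x - y| / 2 := by rw [hu, abs_div, abs_two]
  let c : ℕ → ℝ := fun m => -2 * Real.sin ((2 * n + 1 - 2 * m) * u)
  -- The shift by `π/2` writes the midpoint sine as a cosine.
  let z : ℕ → ℝ := fun m =>
    cesaroNumber (δ - 1) m * Real.cos (((2 * n + 1) * w - Real.pi / 2) - 2 * m * w)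
  have e : cesaroCos δ n x - cesaroCos δ n y = ∑ m ∈ Finset.range (n + 1), c m * z m := by
    rw [cesaroCos, cesaroCos, ← Finset.sum_sub_distrib]
    refine Finset.sum_congr rfl fun m _ => ?_
    have e1 : ((2 * n + 1) * w - Real.pi / 2) - 2 * m * w =
      (2 * n + 1 - 2 * m) * w - Real.pi / 2 := by ring
    simp only [c, z]
    rw [← mul_sub, Real.cos_sub_cos, e1, Real.cos_sub_pi_div_two, hw, hu]
    have e2 : ((2 * n + 1) * x - 2 * m * x + ((2 * n + 1) * y - 2 * m * y)) / 2 =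
      (2 * n + 1 - 2 * m) * ((x + y) / 2) := by ring
    have e3 : ((2 * n + 1) * x - 2 * m * x - ((2 * n + 1) * y - 2 * m * y)) / 2 =
      (2 * n + 1 - 2 * m) * ((x - y) / 2) := by ring
    rw [e2, e3]
    ring
  rw [e]
  refine (abs_sum_mul_le c z ((2 / δ + 1) * |Real.sin w| ^ (-δ)) (n * (2 * |x - y|)) (|x - y|) n
    (fun j _ => abs_sum_cesaroNumber_mul_cos_le h0 h1 _ w hs j) ?_ ?_).trans ?_
  · have h := Real.abs_sin_sub_sin_le ((2 * n + 1 - 2 * n) * u) 0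
    simp only [Real.sin_zero, sub_zero] at h
    have e4 : (2 * (n : ℝ) + 1 - 2 * n) * u = u := by ring
    simp only [c]
    rw [e4] at h ⊢
    rw [abs_mul, abs_neg, abs_two]
    linarith
  · have hterm : ∀ m ∈ Finset.range n, |c (m + 1) - c m| ≤ 2 * |x - y| := by
      intro m _
      have h := Real.abs_sin_sub_sin_le ((2 * n + 1 - 2 * ((m + 1 : ℕ) : ℝ)) * u)
        ((2 * n + 1 - 2 * m) * u)
      have e5 : (2 * n + 1 - 2 * ((m + 1 : ℕ) : ℝ)) * u - (2 * n + 1 - 2 * m) * u = -2 * u := by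
        push_cast; ring
      rw [e5, abs_mul, abs_neg, abs_two] at h
      simp only [c]
      rw [← mul_sub, abs_mul, abs_neg, abs_two]
      linarith
    refine (Finset.sum_le_sum hterm).trans ?_
    simp
  · refine mul_le_mul_of_nonneg_right ?_ (by positivity)
    nlinarith [abs_nonneg (x - y)]

/-! ### Closed form of the Dirichlet and Cesàro kernels -/

theorem sub_one_mul_sum_Icc_zpow {Y : ℂ} (hY : Y ≠ 0) {p q : ℤ} (hpq : p ≤ q + 1) :
    (Y - 1) * ∑ b ∈ Finset.Icc p q, Y ^ b = Y ^ (q + 1) - Y ^ p := by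
  obtain ⟨k, hk⟩ := Int.eq_ofNat_of_zero_le (show 0 ≤ q + 1 - p by omega)
  obtain rfl : q = p + k - 1 := by omega
  clear hpq hk
  induction k with
  | zero => simp
  | succ k ih =>
    have e : Finset.Icc p (p + ((k + 1 : ℕ) : ℤ) - 1) =
        insert (p + k) (Finset.Icc p (p + (k : ℤ) - 1)) := by
      ext b; simp only [Finset.mem_Icc, Finset.mem_insert]; push_cast; omega
    rw [e, Finset.sum_insert (by simp), mul_add, ih]
    have e2 : p + ((k + 1 : ℕ) : ℤ) - 1 + 1 = p + k + 1 := by push_cast; ring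
    have e3 : p + (k : ℤ) - 1 + 1 = p + k := by ring
    rw [e2, e3, zpow_add_one₀ hY]
    ring

theorem sum_hexIndex_zpow (X Y : ℂ) (n : ℕ) :
    ∑ j ∈ hexIndex n, X ^ j 0 * Y ^ j 1 =
      ∑ a ∈ Finset.Icc (-(n : ℤ)) n,
        ∑ b ∈ Finset.Icc (max (-(n : ℤ)) (-n - a)) (min (n : ℤ) (n - a)), X ^ a * Y ^ b := by
  rw [Finset.sum_sigma']
  refine Finset.sum_bij' (fun j _ => (⟨j 0, j 1⟩ : Σ _ : ℤ, ℤ))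
    (fun p _ => ![p.1, p.2, -p.1 - p.2]) ?_ ?_ ?_ ?_ ?_
  · intro j hj
    simp only [hexIndex, Finset.mem_filter, Fintype.mem_piFinset, Finset.mem_Icc,
      Fin.forall_fin_succ, Finset.mem_sigma] at hj ⊢
    simp at hj
    simp only [max_le_iff, le_min_iff]
    omega
  · rintro ⟨a, b⟩ hp
    simp only [hexIndex, Finset.mem_filter, Fintype.mem_piFinset, Finset.mem_Icc,
      Fin.forall_fin_succ, Finset.mem_sigma, max_le_iff, le_min_iff] at hp ⊢
    simp
    omega
  · intro j hj
    simp only [hexIndex, Finset.mem_filter] at hj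
    ext i
    fin_cases i <;> simp
    omega
  · rintro ⟨a, b⟩ _
    simp
  · intro j _
    rfl

/-- Each row of the hexagon is a geometric sum in `Y` whose ends depend on the sign of `a`. Since `X
/ Y = Z`, the row ends are geometric in `X` and `Z` again. Keeping the factors on the left covers
the degenerate values `1`. -/
theorem mul_sum_hexIndex_zpow {X Y Z : ℂ} (hX : X ≠ 0) (hY : Y ≠ 0) (hZ : Z * Y = X) (n : ℕ) :
    (X - 1) * (Y - 1) * (Z - 1) * ∑ j ∈ hexIndex n, X ^ j 0 * Y ^ j 1 =
      (X - 1) * Y ^ (n + 1) * (Z ^ (n + 1) - 1) - (Z - 1) * (Y ^ n)⁻¹ * (X ^ (n + 1) - 1) +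
      (Z - 1) * Y ^ (n + 1) * (1 - (X ^ n)⁻¹) - (X - 1) * (Y ^ n)⁻¹ * (1 - (Z ^ n)⁻¹) := by
  have hZ0 : Z ≠ 0 := by rintro rfl; exact hX (by simpa using hZ.symm)
  have hZe : ∀ a : ℤ, X ^ a = Z ^ a * Y ^ a := fun a => by rw [← hZ, mul_zpow]
  have row : ∀ a ∈ Finset.Icc (-(n : ℤ)) n, (Y - 1) *
      ∑ b ∈ Finset.Icc (max (-(n : ℤ)) (-n - a)) (min (n : ℤ) (n - a)), X ^ a * Y ^ b =
      if 0 ≤ a then Y ^ (n + 1) * Z ^ a - (Y ^ n)⁻¹ * X ^ a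
      else Y ^ (n + 1) * X ^ a - (Y ^ n)⁻¹ * Z ^ a := by
    intro a ha
    rw [Finset.mem_Icc] at ha
    have hle : max (-(n : ℤ)) (-n - a) ≤ min (n : ℤ) (n - a) + 1 := by omega
    rw [← Finset.mul_sum, mul_left_comm, sub_one_mul_sum_Icc_zpow hY hle]
    have hYa : Y ^ a ≠ 0 := zpow_ne_zero _ hY
    have hYn : Y ^ n ≠ 0 := pow_ne_zero _ hY
    split_ifs with h
    · have e1 : max (-(n : ℤ)) (-n - a) = -n := by omega
      have e2 : min (n : ℤ) (n - a) + 1 = ((n + 1 : ℕ) : ℤ) - a := by push_cast; omega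
      rw [e1, e2, zpow_sub₀ hY, zpow_neg, zpow_natCast, zpow_natCast, hZe]
      field_simp
    · have e1 : max (-(n : ℤ)) (-n - a) = -n - a := by omega
      have e2 : min (n : ℤ) (n - a) + 1 = ((n + 1 : ℕ) : ℤ) := by push_cast; omega
      rw [e1, e2, zpow_sub₀ hY, zpow_neg, zpow_natCast, zpow_natCast, hZe]
      field_simp
  have split : Finset.Icc (-(n : ℤ)) n = Finset.Icc 0 (n : ℤ) ∪ Finset.Icc (-(n : ℤ)) (-1) := by
    ext a; simp only [Finset.mem_union, Finset.mem_Icc]; omega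
  have disj : Disjoint (Finset.Icc 0 (n : ℤ)) (Finset.Icc (-(n : ℤ)) (-1)) := by
    rw [Finset.disjoint_left]; intro a h1 h2; rw [Finset.mem_Icc] at h1 h2; omega
  have hsum : (Y - 1) * ∑ j ∈ hexIndex n, X ^ j 0 * Y ^ j 1 =
      Y ^ (n + 1) * ∑ a ∈ Finset.Icc 0 (n : ℤ), Z ^ a
        - (Y ^ n)⁻¹ * ∑ a ∈ Finset.Icc 0 (n : ℤ), X ^ a
      + (Y ^ (n + 1) * ∑ a ∈ Finset.Icc (-(n : ℤ)) (-1), X ^ a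
        - (Y ^ n)⁻¹ * ∑ a ∈ Finset.Icc (-(n : ℤ)) (-1), Z ^ a) := by
    rw [sum_hexIndex_zpow, Finset.mul_sum, Finset.sum_congr rfl row, split,
      Finset.sum_union disj]
    simp only [Finset.mul_sum, ← Finset.sum_sub_distrib]
    congr 1
    · refine Finset.sum_congr rfl fun a ha => if_pos (Finset.mem_Icc.1 ha).1
    · refine Finset.sum_congr rfl fun a ha => if_neg ?_
      have := (Finset.mem_Icc.1 ha).2
      omega
  have gX1 := sub_one_mul_sum_Icc_zpow hX (show (0 : ℤ) ≤ n + 1 by omega)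
  have gZ1 := sub_one_mul_sum_Icc_zpow hZ0 (show (0 : ℤ) ≤ n + 1 by omega)
  have gX2 := sub_one_mul_sum_Icc_zpow hX (show (-(n : ℤ)) ≤ -1 + 1 by omega)
  have gZ2 := sub_one_mul_sum_Icc_zpow hZ0 (show (-(n : ℤ)) ≤ -1 + 1 by omega)
  have c1 : ((n : ℤ) + 1) = ((n + 1 : ℕ) : ℤ) := by push_cast; rfl
  rw [c1] at gX1 gZ1
  simp only [zpow_natCast, zpow_zero, zpow_neg, neg_add_cancel] at gX1 gZ1 gX2 gZ2
  linear_combination (X - 1) * (Z - 1) * hsum + (X - 1) * Y ^ (n + 1) * gZ1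
    - (Z - 1) * (Y ^ n)⁻¹ * gX1 + (Z - 1) * Y ^ (n + 1) * gX2 - (X - 1) * (Y ^ n)⁻¹ * gZ2

/-- The previous identity at `X = v⁻²`, `Y = u²`, `Z = (uv)⁻²`, with `U = u^n`, `V = v^n`.
Multiplying by `v²` centres the exponents and reveals the symmetry in the three angles. -/
theorem hexagon_geometric_identity {u v U V D : ℂ} (hu : u ≠ 0) (hv : v ≠ 0) (hU : U ≠ 0)
    (hV : V ≠ 0)
    (h : ((v ^ 2)⁻¹ - 1) * (u ^ 2 - 1) * ((u ^ 2 * v ^ 2)⁻¹ - 1) * D =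
      ((v ^ 2)⁻¹ - 1) * (U ^ 2 * u ^ 2) * ((U ^ 2 * V ^ 2 * (u ^ 2 * v ^ 2))⁻¹ - 1)
      - ((u ^ 2 * v ^ 2)⁻¹ - 1) * (U ^ 2)⁻¹ * ((V ^ 2 * v ^ 2)⁻¹ - 1)
      + ((u ^ 2 * v ^ 2)⁻¹ - 1) * (U ^ 2 * u ^ 2) * (1 - V ^ 2)
      - ((v ^ 2)⁻¹ - 1) * (U ^ 2)⁻¹ * (1 - U ^ 2 * V ^ 2)) :
    D * ((u⁻¹ - u) * (v⁻¹ - v) * (u * v - (u * v)⁻¹)) =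
      (u * U ^ 2 + (u * U ^ 2)⁻¹) * (u⁻¹ - u) + (v * V ^ 2 + (v * V ^ 2)⁻¹) * (v⁻¹ - v)
      + (u * v * (U * V) ^ 2 + (u * v * (U * V) ^ 2)⁻¹) * (u * v - (u * v)⁻¹) := by
  have e : D * ((u⁻¹ - u) * (v⁻¹ - v) * (u * v - (u * v)⁻¹)) =
      v ^ 2 * (((v ^ 2)⁻¹ - 1) * (u ^ 2 - 1) * ((u ^ 2 * v ^ 2)⁻¹ - 1) * D) := by
    field_simp
    ring
  rw [e, h]
  field_simp
  ring

/-- The half-angle coordinates `π (t_j - t_k) / 3` of a point of the plane. -/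
noncomputable def angle (t : Fin 3 → ℝ) : Fin 3 → ℝ :=
  ![Real.pi * (t 1 - t 2) / 3, Real.pi * (t 2 - t 0) / 3, Real.pi * (t 0 - t 1) / 3]

theorem dirichletKernel_mul_sin (t : Fin 3 → ℝ) (n : ℕ) :
    dirichletKernel n t *
      ((Real.sin (angle t 0) * Real.sin (angle t 1) * Real.sin (angle t 2) : ℝ) : ℂ) =
    ((-(1 / 2) * (Real.cos ((2 * n + 1) * angle t 0) * Real.sin (angle t 0)
      + Real.cos ((2 * n + 1) * angle t 1) * Real.sin (angle t 1)
      + Real.cos ((2 * n + 1) * angle t 2) * Real.sin (angle t 2)) : ℝ) : ℂ) := by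
  set s1 := angle t 0 with hs1
  set s2 := angle t 1 with hs2
  have hs3 : angle t 2 = -(s1 + s2) := by simp [hs1, hs2, angle]; ring
  rw [hs3]
  set u := Complex.exp (s1 * Complex.I) with hu
  set v := Complex.exp (s2 * Complex.I) with hv
  have hu0 : u ≠ 0 := Complex.exp_ne_zero _
  have hv0 : v ≠ 0 := Complex.exp_ne_zero _
  have hD : dirichletKernel n t =
      ∑ j ∈ hexIndex n, ((v ^ 2)⁻¹) ^ j 0 * (u ^ 2) ^ j 1 := by
    refine Finset.sum_congr rfl fun j hj => ?_
    simp only [hexIndex, Finset.mem_filter] at hj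
    have hj2 : j 2 = -j 0 - j 1 := by omega
    rw [phi, hu, hv, ← Complex.exp_nat_mul, ← Complex.exp_nat_mul, ← Complex.exp_neg,
      ← Complex.exp_int_mul, ← Complex.exp_int_mul, ← Complex.exp_add]
    congr 1
    simp only [Fin.sum_univ_three, hj2, hs1, hs2, angle]
    push_cast
    simp
    ring
  have hZ : (u ^ 2 * v ^ 2)⁻¹ * u ^ 2 = (v ^ 2)⁻¹ := by field_simp
  have key := mul_sum_hexIndex_zpow (X := (v ^ 2)⁻¹) (Y := u ^ 2) (by positivity) (by positivity)
    hZ n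
  rw [← hD] at key
  have hid := hexagon_geometric_identity (u := u) (v := v) (U := u ^ n) (V := v ^ n)
    (D := dirichletKernel n t) hu0 hv0 (pow_ne_zero _ hu0) (pow_ne_zero _ hv0) (by
      rw [key]
      simp only [inv_pow, mul_pow, pow_succ, inv_inv, pow_zero, one_mul]
      ring_nf)
  have hue : u⁻¹ = Complex.exp (-s1 * Complex.I) := by rw [hu, ← Complex.exp_neg]; ring_nf
  have hve : v⁻¹ = Complex.exp (-s2 * Complex.I) := by rw [hv, ← Complex.exp_neg]; ring_nf
  have huv : u * v = Complex.exp ((s1 + s2) * Complex.I) := by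
    rw [hu, hv, ← Complex.exp_add]; ring_nf
  have huv' : (u * v)⁻¹ = Complex.exp (-(s1 + s2) * Complex.I) := by
    rw [huv, ← Complex.exp_neg]; ring_nf
  have cosE : ∀ (s : ℝ) (w : ℂ), w = Complex.exp (s * Complex.I) →
      Complex.cos ((2 * n + 1) * s) = (w * (w ^ n) ^ 2 + (w * (w ^ n) ^ 2)⁻¹) / 2 := by
    intro s w hw
    have e : w * (w ^ n) ^ 2 = Complex.exp ((2 * n + 1) * s * Complex.I) := by
      rw [hw, ← pow_mul, ← Complex.exp_nat_mul, ← Complex.exp_add]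
      push_cast; ring_nf
    rw [e, ← Complex.exp_neg, Complex.cos]
    ring_nf
  have sinE : ∀ (s : ℝ) (w : ℂ), w = Complex.exp (s * Complex.I) →
      Complex.sin s = (w⁻¹ - w) * Complex.I / 2 := by
    intro s w hw
    rw [hw, ← Complex.exp_neg, Complex.sin]
    ring_nf
  have c3 := cosE (s1 + s2) (u * v) (by rw [huv]; push_cast; rfl)
  have n3 := sinE (s1 + s2) (u * v) (by rw [huv]; push_cast; rfl)
  have e3 : (2 * (n : ℝ) + 1) * -(s1 + s2) = -((2 * n + 1) * (s1 + s2)) := by ring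
  rw [e3, Real.cos_neg, Real.sin_neg]
  push_cast
  push_cast at c3 n3
  rw [cosE s1 u rfl, cosE s2 v rfl, c3, sinE s1 u rfl, sinE s2 v rfl, n3]
  have hI : Complex.I ^ 3 = -Complex.I := by rw [pow_succ, Complex.I_sq]; ring
  rw [mul_pow u v n]
  linear_combination (-Complex.I / 8) * hid + (1 / 8) * (dirichletKernel n t *
    ((u⁻¹ - u) * (v⁻¹ - v) * (u * v - (u * v)⁻¹))) * hI

theorem cesaroKernel_mul_sin (t : Fin 3 → ℝ) (δ : ℝ) (n : ℕ) :
    cesaroKernel δ n t *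
      ((Real.sin (angle t 0) * Real.sin (angle t 1) * Real.sin (angle t 2) : ℝ) : ℂ) =
    ((-(1 / (2 * cesaroNumber δ n)) * (cesaroCos δ n (angle t 0) * Real.sin (angle t 0)
      + cesaroCos δ n (angle t 1) * Real.sin (angle t 1)
      + cesaroCos δ n (angle t 2) * Real.sin (angle t 2)) : ℝ) : ℂ) := by
  rw [cesaroKernel, mul_assoc, Finset.sum_mul]
  simp only [mul_assoc (Complex.ofReal (cesaroNumber (δ - 1) _)), dirichletKernel_mul_sin t,
    ← Complex.ofReal_mul, ← Complex.ofReal_sum]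
  rw [← Complex.ofReal_one, ← Complex.ofReal_div, ← Complex.ofReal_mul, Complex.ofReal_inj]
  simp only [cesaroCos_eq_sum, Finset.sum_mul, ← Finset.sum_add_distrib, Finset.mul_sum]
  refine Finset.sum_congr rfl fun k _ => ?_
  have hA : (2 * cesaroNumber δ n)⁻¹ = 2⁻¹ * (cesaroNumber δ n)⁻¹ := mul_inv _ _
  rw [one_div, one_div, one_div, hA]
  ring

/-! ### Pointwise estimate of the kernel -/

theorem norm_phi (j : Fin 3 → ℤ) (t : Fin 3 → ℝ) : ‖phi j t‖ = 1 := by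
  have e : phi j t =
      Complex.exp (((2 * Real.pi / 3 * ∑ i, (j i : ℝ) * t i : ℝ) : ℂ) * Complex.I) := by
    rw [phi]; push_cast; ring_nf
  rw [e, Complex.norm_exp_ofReal_mul_I]

theorem norm_dirichletKernel_le (n : ℕ) (t : Fin 3 → ℝ) :
    ‖dirichletKernel n t‖ ≤ (2 * (n : ℝ) + 1) ^ 2 := by
  refine (norm_sum_le _ _).trans ?_
  simp only [norm_phi, Finset.sum_const, nsmul_eq_mul, mul_one]
  have h : (hexIndex n).card ≤ (Finset.Icc (-(n : ℤ)) n ×ˢ Finset.Icc (-(n : ℤ)) n).card := by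
    refine Finset.card_le_card_of_injOn (fun j => (j 0, j 1)) ?_ ?_
    · intro j hj
      simp only [hexIndex, Finset.coe_filter, Fintype.mem_piFinset, Set.mem_ofPred_eq] at hj
      simp only [Finset.coe_product, Set.mem_prod, Finset.mem_coe]
      exact ⟨hj.1 0, hj.1 1⟩
    · intro i hi j hj hij
      simp only [hexIndex, Finset.coe_filter, Set.mem_ofPred_eq] at hi hj
      simp only [Prod.mk.injEq] at hij
      ext k
      fin_cases k
      · exact hij.1
      · exact hij.2
      · simp; omega
  have e : (Finset.Icc (-(n : ℤ)) n ×ˢ Finset.Icc (-(n : ℤ)) n).card = (2 * n + 1) ^ 2 := by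
    rw [Finset.card_product, Int.card_Icc]
    have : ((n : ℤ) + 1 - -n).toNat = 2 * n + 1 := by omega
    rw [this]; ring
  rw [e] at h
  exact_mod_cast h

theorem norm_cesaroKernel_le {δ : ℝ} (h0 : 0 < δ) (n : ℕ) (t : Fin 3 → ℝ) :
    ‖cesaroKernel δ n t‖ ≤ 4 * ((n : ℝ) + 1) ^ 2 := by
  have hA := cesaroNumber_pos (show -1 < δ by linarith) n
  rw [cesaroKernel, norm_mul, norm_div, norm_one, Complex.norm_real, Real.norm_of_nonneg hA.le,
    one_div, inv_mul_le_iff₀ hA]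
  calc _ ≤ ∑ k ∈ Finset.range (n + 1), cesaroNumber (δ - 1) (n - k) * (4 * ((n : ℝ) + 1) ^ 2) := by
        refine (norm_sum_le _ _).trans (Finset.sum_le_sum fun k hk => ?_)
        have ha := cesaroNumber_pos (show -1 < δ - 1 by linarith) (n - k)
        have hk : (k : ℝ) ≤ n := by
          have := Finset.mem_range.1 hk
          exact_mod_cast (by omega : k ≤ n)
        rw [norm_mul, Complex.norm_real, Real.norm_of_nonneg ha.le]
        refine mul_le_mul_of_nonneg_left ((norm_dirichletKernel_le k t).trans ?_) ha.le
        nlinarith [k.cast_nonneg (α := ℝ)]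
    _ = cesaroNumber δ n * (4 * ((n : ℝ) + 1) ^ 2) := by
        rw [← Finset.sum_mul, ← sum_cesaroNumber_sub_one_eq h0]
        congr 1
        exact Finset.sum_range_reflect (fun m => cesaroNumber (δ - 1) m) (n + 1) ▸ by simp

/-- Jordan's inequality up to `π/2`; beyond, it is applied to `π - x`, which is at least `x/2`
because `x ≤ 2π/3`. -/
theorem abs_div_four_le_abs_sin {s : ℝ} (hs : |s| ≤ 2 * Real.pi / 3) :
    |s| / 4 ≤ |Real.sin s| := by
  have hpi := Real.pi_pos
  have hpi4 := Real.pi_le_four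
  have key : ∀ x : ℝ, 0 ≤ x → x ≤ 2 * Real.pi / 3 → x / 4 ≤ Real.sin x := by
    intro x h0 hx
    have h1 : x / 4 ≤ 1 / Real.pi * x := by
      rw [div_eq_mul_one_div, mul_comm]
      gcongr
    refine h1.trans ?_
    rcases le_total x (Real.pi / 2) with h | h
    · refine le_trans ?_ (Real.mul_le_sin h0 h)
      gcongr
      norm_num
    · rw [← Real.sin_pi_sub]
      refine le_trans ?_ (Real.mul_le_sin (x := Real.pi - x) (by linarith) (by linarith))
      rw [div_mul_eq_mul_div, div_mul_eq_mul_div]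
      exact div_le_div_of_nonneg_right (by linarith) hpi.le
  have h := key |s| (abs_nonneg s) hs
  refine h.trans ?_
  rcases abs_cases s with ⟨e, _⟩ | ⟨e, _⟩ <;> rw [e]
  · exact le_abs_self _
  · rw [Real.sin_neg]; exact neg_le_abs _

theorem abs_cesaroCos_le_of_le {δ : ℝ} (h0 : 0 < δ) (h1 : δ < 1) (n : ℕ) {s r M : ℝ}
    (hr : 0 < r) (hM : 1 ≤ M) (hs : r / M ≤ |Real.sin s|) :
    |cesaroCos δ n s| ≤ (2 / δ + 1) * (M * r ^ (-δ)) ∧ Real.sin s ≠ 0 ∧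
      |Real.sin s| ^ (-δ) ≤ M * r ^ (-δ) := by
  have hM0 : 0 < M := by linarith
  have hq : 0 < r / M := by positivity
  have hne : Real.sin s ≠ 0 := abs_pos.1 (hq.trans_le hs)
  have hle : |Real.sin s| ^ (-δ) ≤ M * r ^ (-δ) := by
    refine (Real.rpow_le_rpow_of_nonpos hq hs (by linarith)).trans ?_
    rw [Real.div_rpow hr.le hM0.le, Real.rpow_neg hM0.le, div_inv_eq_mul, mul_comm]
    have : M ^ δ ≤ M := by simpa using Real.rpow_le_rpow_of_exponent_le hM h1.le
    gcongr
  refine ⟨(abs_cesaroCos_le h0 h1 n hne).trans ?_, hne, hle⟩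
  have : 0 ≤ 2 / δ + 1 := by positivity
  gcongr

theorem mul_rpow_neg_sub {δ r : ℝ} (hr : 0 < r) : r * r ^ (-δ) = r ^ (1 - δ) := by
  rw [sub_eq_add_neg, Real.rpow_add hr, Real.rpow_one]

/-- The trigonometric numerator of the Cesàro kernel when the first angle is the smallest and the
largest one is `R`. -/
theorem abs_numerator_le {δ : ℝ} (h0 : 0 < δ) (h1 : δ < 1) (n : ℕ) {x y z R : ℝ}
    (hsum : x + y + z = 0) (hx : x ≠ 0) (hxy : |x| ≤ |y|) (hxz : |x| ≤ |z|)
    (hyR : |y| ≤ R) (hzR : |z| ≤ R) (hR : R ≤ |y| ∨ R ≤ |z|) (hpi : R ≤ 2 * Real.pi / 3)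
    (hN : 1 ≤ ((n : ℝ) + 1) * R) :
    |cesaroCos δ n x * Real.sin x + cesaroCos δ n y * Real.sin y + cesaroCos δ n z * Real.sin z| ≤
      |x| * R * cesaroNumber δ n * (400 * (2 / δ + 1)) *
        (((n : ℝ) + 1) ^ (-δ) * R ^ (-δ) / (|x| + 1 / ((n : ℝ) + 1))) := by
  have hN0 : (0 : ℝ) < n + 1 := by positivity
  set N : ℝ := n + 1 with hNdef
  set C := 2 / δ + 1 with hC
  set A := cesaroNumber δ n with hAdef
  have hxp : 0 < |x| := abs_pos.2 hx
  have hRp : 0 < R := hxp.trans_le (hxy.trans hyR)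
  have hδ2 : 2 ≤ 2 / δ := by rw [le_div_iff₀ h0]; linarith
  have hC1 : 1 ≤ C := by linarith
  have hA : 0 < A := cesaroNumber_pos (by linarith) n
  -- This inserts the factor `A`, later cancelled by the prefactor of the kernel, at the price of `N
  -- ^ (-δ)`.
  have hAN : 1 ≤ A * N ^ (-δ) := by
    rw [Real.rpow_neg hN0.le, ← div_eq_mul_inv, one_le_div (by positivity)]
    exact rpow_le_cesaroNumber h0 h1 n
  have hRδ : 0 < R ^ (-δ) := by positivity
  rcases le_or_gt 1 (N * |x|) with hq | hq
  · have term : ∀ s : ℝ, |x| ≤ |s| → |s| ≤ R →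
        |cesaroCos δ n s * Real.sin s| ≤ 4 * C * (R * R ^ (-δ)) := by
      intro s hs1 hs2
      have hs0 : 0 < |s| := hxp.trans_le hs1
      obtain ⟨hF, -, -⟩ := abs_cesaroCos_le_of_le h0 h1 n hs0 (show (1 : ℝ) ≤ 4 by norm_num)
        (abs_div_four_le_abs_sin (hs2.trans hpi))
      rw [abs_mul]
      calc _ ≤ C * (4 * |s| ^ (-δ)) * |s| :=
          mul_le_mul hF Real.abs_sin_le_abs (abs_nonneg _) (by positivity)
        _ = 4 * C * |s| ^ (1 - δ) := by rw [← mul_rpow_neg_sub hs0]; ring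
        _ ≤ 4 * C * R ^ (1 - δ) := by gcongr
        _ = _ := by rw [← mul_rpow_neg_sub hRp]
    have hsum3 : |cesaroCos δ n x * Real.sin x + cesaroCos δ n y * Real.sin y
        + cesaroCos δ n z * Real.sin z| ≤ 12 * C * (R * R ^ (-δ)) := by
      refine (abs_add_three _ _ _).trans ?_
      linarith [term x le_rfl (hxy.trans hyR), term y hxy hyR, term z hxz hzR]
    refine hsum3.trans ?_
    have hfrac : 1 / 2 ≤ |x| / (|x| + 1 / N) := by
      rw [div_le_div_iff₀ (by norm_num) (by positivity)]
      have : 1 / N ≤ |x| := by rw [div_le_iff₀ hN0]; linarith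
      linarith
    calc 12 * C * (R * R ^ (-δ)) ≤ 400 * C * (R * R ^ (-δ)) * (1 * (1 / 2)) := by
          nlinarith [mul_pos (mul_pos (lt_of_lt_of_le one_pos hC1) hRp) hRδ]
      _ ≤ 400 * C * (R * R ^ (-δ)) * ((A * N ^ (-δ)) * (|x| / (|x| + 1 / N))) := by gcongr
      _ = _ := by ring
  -- Case `|x| < 1/N`: the `x` term already has the factor `|x|`, and the `y` and `z` terms are
  -- paired by comparing `y` with `-z`.
  · have hR2 : R / 2 ≤ |y| := by
      have : |z| ≤ |x| + |y| := by
        have e : z = -(x + y) := by linarith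
        rw [e, abs_neg]; exact abs_add_le _ _
      rcases hR with h | h <;> linarith
    have hF : |cesaroCos δ n x * Real.sin x| ≤ A * |x| := by
      rw [abs_mul]
      exact mul_le_mul (abs_cesaroCos_le_cesaroNumber h0 n x) Real.abs_sin_le_abs
        (abs_nonneg _) hA.le
    have hw : |(y + -z) / 2| ≤ 2 * Real.pi / 3 := by
      rw [abs_div, abs_two]
      have := abs_add_le y (-z)
      rw [abs_neg] at this
      linarith
    have hw2 : R / 4 ≤ |(y + -z) / 2| := by
      rw [abs_div, abs_two]
      have e : y = ((y + -z) + -x) / 2 := by linarith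
      have := abs_add_le (y + -z) (-x)
      rw [abs_neg] at this
      have h2 : |y| = |y + -z + -x| / 2 := by
        conv_lhs => rw [e]
        rw [abs_div, abs_two]
      linarith
    -- The sines at `y` and at the midpoint are at least `R/8` and `R/16`; `32` serves for both.
    obtain ⟨hFy, -, -⟩ := abs_cesaroCos_le_of_le h0 h1 n (s := y) hRp
      (show (1 : ℝ) ≤ 32 by norm_num)
      (by have := abs_div_four_le_abs_sin (hyR.trans hpi); linarith)
    obtain ⟨-, hne, hsw⟩ := abs_cesaroCos_le_of_le h0 h1 n (s := (y + -z) / 2) hRp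
      (show (1 : ℝ) ≤ 32 by norm_num)
      (by have := abs_div_four_le_abs_sin hw; linarith)
    have hd := abs_cesaroCos_sub_le h0 h1 n hne
    have ex : y - -z = -x := by linarith
    rw [ex, abs_neg, cesaroCos_neg] at hd
    have hsin := Real.abs_sin_sub_sin_le y (-z)
    rw [ex, abs_neg, Real.sin_neg] at hsin
    have hyz : |cesaroCos δ n y * Real.sin y + cesaroCos δ n z * Real.sin z| ≤
        C * (32 * R ^ (-δ)) * |x| + 2 * N * |x| * (C * (32 * R ^ (-δ))) * R := by
      have e : cesaroCos δ n y * Real.sin y + cesaroCos δ n z * Real.sin z =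
        cesaroCos δ n y * (Real.sin y - -Real.sin z)
          + (cesaroCos δ n y - cesaroCos δ n z) * (-Real.sin z) := by ring
      rw [e]
      refine (abs_add_le _ _).trans ?_
      rw [abs_mul, abs_mul, abs_neg (Real.sin z)]
      have hz : |Real.sin z| ≤ R := Real.abs_sin_le_abs.trans hzR
      gcongr
      refine hd.trans ?_
      gcongr
    have hNR : 1 ≤ (N * R) * (N ^ (-δ) * R ^ (-δ)) := by
      rw [← Real.mul_rpow hN0.le hRp.le, mul_rpow_neg_sub (by positivity)]
      exact Real.one_le_rpow hN (by linarith)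
    have hfrac : N / 2 ≤ 1 / (|x| + 1 / N) := by
      rw [div_le_div_iff₀ (by norm_num) (by positivity), mul_add, mul_one_div_cancel hN0.ne']
      linarith
    have hFx : A * |x| ≤ 100 * (A * |x| * C * ((N * R) * (N ^ (-δ) * R ^ (-δ)))) := by
      have h2 : A * |x| * 1 * 1 ≤ A * |x| * C * ((N * R) * (N ^ (-δ) * R ^ (-δ))) := by gcongr
      have : 0 < A * |x| := by positivity
      linarith
    have hFyz : C * (32 * R ^ (-δ)) * |x| + 2 * N * |x| * (C * (32 * R ^ (-δ))) * R ≤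
        100 * (A * |x| * C * ((N * R) * (N ^ (-δ) * R ^ (-δ)))) := by
      have hp : 0 < C * R ^ (-δ) * |x| := by positivity
      calc _ = 32 * (C * R ^ (-δ) * |x|) * (1 + 2 * (N * R)) := by ring
        _ ≤ 32 * (C * R ^ (-δ) * |x|) * (3 * (N * R)) := by gcongr; linarith
        _ ≤ 100 * (C * R ^ (-δ) * |x| * (N * R)) * 1 := by
          have : 0 < C * R ^ (-δ) * |x| * (N * R) := by positivity
          linarith
        _ ≤ 100 * (C * R ^ (-δ) * |x| * (N * R)) * (A * N ^ (-δ)) := by gcongr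
        _ = _ := by ring
    rw [add_assoc]
    refine (abs_add_le _ _).trans ?_
    calc _ ≤ 200 * (A * |x| * C * ((N * R) * (N ^ (-δ) * R ^ (-δ)))) := by linarith
      _ = |x| * R * A * (400 * C) * (N ^ (-δ) * R ^ (-δ)) * (N / 2) := by ring
      _ ≤ |x| * R * A * (400 * C) * (N ^ (-δ) * R ^ (-δ)) * (1 / (|x| + 1 / N)) := by gcongr
      _ = _ := by ring

/-- A quantity `k` satisfying the trivial bound and the product formula of the Cesàro kernel decays
like the kernel; `x` is the smallest of the three angles and `R` the largest. -/
theorem mul_le_of_mul_abs_sin_eq {δ : ℝ} (h0 : 0 < δ) (h1 : δ < 1) (n : ℕ) {x y z R k : ℝ}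
    (hsum : x + y + z = 0) (hx : x ≠ 0) (hxy : |x| ≤ |y|) (hxz : |x| ≤ |z|)
    (hyR : |y| ≤ R) (hzR : |z| ≤ R) (hR : R ≤ |y| ∨ R ≤ |z|) (hpi : R ≤ 2 * Real.pi / 3)
    (hk0 : k ≤ 4 * ((n : ℝ) + 1) ^ 2)
    (hk : k * |Real.sin x * Real.sin y * Real.sin z| = 1 / (2 * cesaroNumber δ n) *
      |cesaroCos δ n x * Real.sin x + cesaroCos δ n y * Real.sin y
        + cesaroCos δ n z * Real.sin z|) :
    R * k ≤ 51200 * (2 / δ + 1) *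
      (((n : ℝ) + 1) ^ (-δ) * R ^ (-δ) / (|x| + 1 / ((n : ℝ) + 1))) := by
  have hN0 : (0 : ℝ) < n + 1 := by positivity
  set N : ℝ := n + 1 with hNdef
  have hxp : 0 < |x| := abs_pos.2 hx
  have hRp : 0 < R := hxp.trans_le (hxy.trans hyR)
  have hδ2 : 2 ≤ 2 / δ := by rw [le_div_iff₀ h0]; linarith
  rcases le_or_gt 1 (N * R) with hN | hN
  · have hA := cesaroNumber_pos (show -1 < δ by linarith) n
    have hnum := abs_numerator_le h0 h1 n hsum hx hxy hxz hyR hzR hR hpi hN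
    rw [← hNdef] at hnum
    set T := N ^ (-δ) * R ^ (-δ) / (|x| + 1 / N) with hT
    have hTp : 0 < T := by positivity
    have hyl : R / 2 ≤ |y| := by
      have : |z| ≤ |x| + |y| := by
        have e : z = -(x + y) := by linarith
        rw [e, abs_neg]; exact abs_add_le _ _
      rcases hR with h | h <;> linarith
    have hzl : R / 2 ≤ |z| := by
      have : |y| ≤ |x| + |z| := by
        have e : y = -(x + z) := by linarith
        rw [e, abs_neg]; exact abs_add_le _ _
      rcases hR with h | h <;> linarith
    have sx := abs_div_four_le_abs_sin (s := x) (by linarith)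
    have sy := abs_div_four_le_abs_sin (s := y) (by linarith)
    have sz := abs_div_four_le_abs_sin (s := z) (by linarith)
    have hP : |x| * R ^ 2 / 256 ≤ |Real.sin x * Real.sin y * Real.sin z| := by
      rw [abs_mul, abs_mul]
      calc |x| * R ^ 2 / 256 = |x| / 4 * (R / 8) * (R / 8) := by ring
        _ ≤ _ := by
          gcongr
          · linarith
          · linarith
    rcases le_or_gt k 0 with hk' | hk'
    · have : R * k ≤ 0 := mul_nonpos_of_nonneg_of_nonpos hRp.le hk'
      exact this.trans (by positivity)
    · have h3 : k * (|x| * R ^ 2 / 256) ≤ 1 / (2 * cesaroNumber δ n) *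
          (|x| * R * cesaroNumber δ n * (400 * (2 / δ + 1)) * T) := by
        calc _ ≤ k * |Real.sin x * Real.sin y * Real.sin z| := by gcongr
          _ ≤ _ := by rw [hk]; gcongr
      -- Here `51200 = 256 · 400 / 2`, with `256 = 4 · 8 · 8` from the lower bound on the three
      -- sines.
      have e : 1 / (2 * cesaroNumber δ n) *
          (|x| * R * cesaroNumber δ n * (400 * (2 / δ + 1)) * T) =
          (|x| * R / 256) * (51200 * (2 / δ + 1) * T) := by field_simp; norm_num
      rw [e] at h3
      have h4 : (|x| * R / 256) * (R * k) ≤ (|x| * R / 256) * (51200 * (2 / δ + 1) * T) := by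
        refine le_trans (le_of_eq ?_) h3
        ring
      exact le_of_mul_le_mul_left h4 (by positivity)
  -- Near the origin the trivial bound gives `R k ≤ 4 N`, and the right-hand fraction is at least
  -- `N/2`.
  · have h2 : 1 ≤ N ^ (-δ) * R ^ (-δ) := by
      rw [← Real.mul_rpow hN0.le hRp.le]
      exact Real.one_le_rpow_of_pos_of_le_one_of_nonpos (by positivity) hN.le (by linarith)
    have h3 : |x| + 1 / N ≤ 2 / N := by
      have : R ≤ 1 / N := by rw [le_div_iff₀ hN0]; linarith
      have e : 2 / N = 1 / N + 1 / N := by ring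
      linarith
    have h4 : R * k ≤ 4 * N := by
      calc R * k ≤ R * (4 * N ^ 2) := by gcongr
        _ = 4 * N * (N * R) := by ring
        _ ≤ 4 * N * 1 := by gcongr
        _ = 4 * N := by ring
    have h5 : N / 2 ≤ N ^ (-δ) * R ^ (-δ) / (|x| + 1 / N) := by
      rw [le_div_iff₀ (by positivity)]
      calc N / 2 * (|x| + 1 / N) ≤ N / 2 * (2 / N) := by gcongr
        _ = 1 := by field_simp
        _ ≤ _ := h2
    nlinarith [mul_le_mul_of_nonneg_right (show (2 : ℝ) ≤ 2 / δ + 1 by linarith)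
      (show 0 ≤ N / 2 by positivity), mul_le_mul_of_nonneg_left h5 (show 0 ≤ 2 / δ + 1 by positivity)]
open MeasureTheory

/-- Each summand serves the case where its linear form gives the smallest angle; the other two are
only nonnegative. The singular coordinate is chosen so that the form still varies when that
coordinate is fixed. -/
theorem hexNorm_mul_norm_cesaroKernel_le {δ : ℝ} (h0 : 0 < δ) (h1 : δ < 1) (n : ℕ) {a b : ℝ}
    (hmem : homog (a, b) ∈ Omega) (ha : a ≠ 0) (hb : b ≠ 0) (h12 : a + 2 * b ≠ 0)
    (h21 : 2 * a + b ≠ 0) (hab : a - b ≠ 0) :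
    hexNorm (homog (a, b)) * ‖cesaroKernel δ n (homog (a, b))‖ ≤
      51200 * (2 / δ + 1) * ((n : ℝ) + 1) ^ (-δ) *
        (|a| ^ (-δ) * (|b + 2 * a| + 1 / ((n : ℝ) + 1))⁻¹
          + |b| ^ (-δ) * (|a + 2 * b| + 1 / ((n : ℝ) + 1))⁻¹
          + |a| ^ (-δ) * (|b + -1 * a| + 1 / ((n : ℝ) + 1))⁻¹) := by
  have hpi3 := Real.pi_gt_three
  set t := homog (a, b) with ht
  have e0 : angle t 0 = Real.pi / 3 * (a + 2 * b) := by simp [angle, ht, homog]; ring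
  have e1 : angle t 1 = -(Real.pi / 3 * (b + 2 * a)) := by simp [angle, ht, homog]; ring
  have e2 : angle t 2 = -(Real.pi / 3 * (b + -1 * a)) := by simp [angle, ht, homog]; ring
  have hP := congrArg norm (cesaroKernel_mul_sin t δ n)
  have hA := cesaroNumber_pos (show -1 < δ by linarith) n
  rw [norm_mul, Complex.norm_real, Complex.norm_real, Real.norm_eq_abs, Real.norm_eq_abs,
    abs_mul (-(1 / (2 * cesaroNumber δ n))), abs_neg, abs_of_pos (show 0 < 1 / (2 * cesaroNumber δ n) by positivity)] at hP
  have hk0 := norm_cesaroKernel_le h0 n t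
  have hkp := norm_nonneg (cesaroKernel δ n t)
  set k := ‖cesaroKernel δ n t‖
  set x := angle t 0
  set y := angle t 1
  set z := angle t 2
  have hsum : x + y + z = 0 := by rw [e0, e1, e2]; ring
  have hx : x ≠ 0 := by rw [e0]; exact mul_ne_zero (by positivity) h12
  have hy : y ≠ 0 := by
    rw [e1]; exact neg_ne_zero.2 (mul_ne_zero (by positivity) (by rwa [add_comm]))
  have hz : z ≠ 0 := by
    rw [e2]
    refine neg_ne_zero.2 (mul_ne_zero (by positivity) fun h => hab (by linarith))
  have lin : ∀ l : ℝ, |l| ≤ |Real.pi / 3 * l| := by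
    intro l
    rw [abs_mul, abs_of_pos (show 0 < Real.pi / 3 by positivity)]
    exact le_mul_of_one_le_left (abs_nonneg l) (by linarith)
  have lx : |a + 2 * b| ≤ |x| := by rw [e0]; exact lin _
  have ly : |b + 2 * a| ≤ |y| := by rw [e1, abs_neg]; exact lin _
  have lz : |b + -1 * a| ≤ |z| := by rw [e2, abs_neg]; exact lin _
  set R := max |x| (max |y| |z|) with hR
  have hxR : |x| ≤ R := le_max_left _ _
  have hyR : |y| ≤ R := (le_max_left _ _).trans (le_max_right _ _)
  have hzR : |z| ≤ R := (le_max_right _ _).trans (le_max_right _ _)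
  have hRor : R = |x| ∨ R = |y| ∨ R = |z| := by
    rcases max_choice |x| (max |y| |z|) with h | h
    · exact Or.inl h
    · rcases max_choice |y| |z| with h' | h'
      · exact Or.inr (Or.inl (h.trans h'))
      · exact Or.inr (Or.inr (h.trans h'))
  obtain ⟨-, ⟨m1, m2⟩, ⟨m3, m4⟩, ⟨m5, m6⟩⟩ := hmem
  simp [ht, homog] at m1 m2 m3 m4 m5 m6
  have hRpi : R ≤ 2 * Real.pi / 3 := by
    have : ∀ l : ℝ, |l| ≤ 2 → |Real.pi / 3 * l| ≤ 2 * Real.pi / 3 := by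
      intro l hl
      rw [abs_mul, abs_of_pos (show 0 < Real.pi / 3 by positivity)]
      nlinarith
    refine max_le ?_ (max_le ?_ ?_)
    · rw [e0]; exact this _ (abs_le.2 ⟨by linarith, by linarith⟩)
    · rw [e1, abs_neg]; exact this _ (abs_le.2 ⟨by linarith, by linarith⟩)
    · rw [e2, abs_neg]; exact this _ (abs_le.2 ⟨by linarith, by linarith⟩)
  have l1 := abs_le.1 (lx.trans hxR)
  have l2 := abs_le.1 (ly.trans hyR)
  have l3 := abs_le.1 (lz.trans hzR)
  -- Each coordinate is a third of a signed sum of two of the forms `a + 2b`, `b + 2a`, `b - a`, all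
  -- bounded by `R`.
  have haR : |a| ≤ R := abs_le.2 ⟨by linarith, by linarith⟩
  have hbR : |b| ≤ R := abs_le.2 ⟨by linarith, by linarith⟩
  have hcR : |-a - b| ≤ R := abs_le.2 ⟨by linarith, by linarith⟩
  have hrR : hexNorm t ≤ R := by
    refine max_le ?_ (max_le ?_ ?_)
    · simpa [ht, homog] using haR
    · simpa [ht, homog] using hbR
    · simpa [ht, homog] using hcR
  have hRp : 0 < R := (abs_pos.2 hx).trans_le hxR
  set N : ℝ := (n : ℝ) + 1
  have hN : 0 < N := by positivity
  refine (mul_le_mul_of_nonneg_right hrR hkp).trans ?_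
  have conv : ∀ c l s : ℝ, c ≠ 0 → |c| ≤ R → |l| ≤ |s| →
      R * k ≤ 51200 * (2 / δ + 1) * (N ^ (-δ) * R ^ (-δ) / (|s| + 1 / N)) →
      R * k ≤ 51200 * (2 / δ + 1) * N ^ (-δ) * (|c| ^ (-δ) * (|l| + 1 / N)⁻¹) := by
    intro c l s hc hcR hl h
    have hc' := abs_pos.2 hc
    refine h.trans ?_
    have hpow : R ^ (-δ) ≤ |c| ^ (-δ) := Real.rpow_le_rpow_of_nonpos hc' hcR (by linarith)
    rw [div_eq_mul_inv (N ^ (-δ) * R ^ (-δ)), mul_assoc (N ^ (-δ)),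
      mul_assoc (51200 * (2 / δ + 1)) (N ^ (-δ))]
    gcongr
  have p1 : 0 ≤ |a| ^ (-δ) * (|b + 2 * a| + 1 / N)⁻¹ := by positivity
  have p2 : 0 ≤ |b| ^ (-δ) * (|a + 2 * b| + 1 / N)⁻¹ := by positivity
  have p3 : 0 ≤ |a| ^ (-δ) * (|b + -1 * a| + 1 / N)⁻¹ := by positivity
  have hmin : (|x| ≤ |y| ∧ |x| ≤ |z|) ∨ (|y| ≤ |x| ∧ |y| ≤ |z|) ∨ (|z| ≤ |x| ∧ |z| ≤ |y|) := by
    rcases le_total |x| |y| with h | h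
    · rcases le_total |x| |z| with h' | h'
      · exact Or.inl ⟨h, h'⟩
      · exact Or.inr (Or.inr ⟨h', h'.trans h⟩)
    · rcases le_total |y| |z| with h' | h'
      · exact Or.inr (Or.inl ⟨h, h'⟩)
      · exact Or.inr (Or.inr ⟨h'.trans h, h'⟩)
  rcases hmin with ⟨h, h'⟩ | ⟨h, h'⟩ | ⟨h, h'⟩
  · refine (conv b (a + 2 * b) x hb hbR lx (mul_le_of_mul_abs_sin_eq h0 h1 n hsum hx h h' hyR hzR
      ?_ hRpi hk0 hP)).trans ?_
    · rcases hRor with e | e | e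
      · exact Or.inl (e.trans_le h)
      · exact Or.inl e.le
      · exact Or.inr e.le
    · gcongr; linarith
  · refine (conv a (b + 2 * a) y ha haR ly (mul_le_of_mul_abs_sin_eq h0 h1 n
      (x := y) (y := x) (z := z) (by linarith) hy h h' hxR hzR ?_ hRpi hk0 ?_)).trans ?_
    · rcases hRor with e | e | e
      · exact Or.inl e.le
      · exact Or.inl (e.trans_le h)
      · exact Or.inr e.le
    · rw [show Real.sin y * Real.sin x = Real.sin x * Real.sin y by ring, hP]
      congr 2; ring
    · gcongr; linarith
  · refine (conv a (b + -1 * a) z ha haR lz (mul_le_of_mul_abs_sin_eq h0 h1 n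
      (x := z) (y := x) (z := y) (by linarith) hz h h' hxR hyR ?_ hRpi hk0 ?_)).trans ?_
    · rcases hRor with e | e | e
      · exact Or.inl e.le
      · exact Or.inr e.le
      · exact Or.inl (e.trans_le h)
    · rw [show Real.sin z * Real.sin x * Real.sin y = Real.sin x * Real.sin y * Real.sin z by ring,
        hP]
      congr 2; ring
    · gcongr; linarith

/-! ### Integration of the majorant -/

theorem integrableOn_abs_rpow_neg {δ : ℝ} (h1 : δ < 1) :
    IntegrableOn (fun x : ℝ => |x| ^ (-δ)) (Set.Icc (-1) 1) := by
  have hp : IntervalIntegrable (fun x : ℝ => |x| ^ (-δ)) volume 0 1 := by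
    refine (intervalIntegral.intervalIntegrable_rpow' (r := -δ) (a := 0) (b := 1)
      (by linarith)).congr ?_
    intro x hx
    rw [Set.uIoc_of_le zero_le_one] at hx
    simp only [abs_of_pos hx.1]
  have hn : IntervalIntegrable (fun x : ℝ => |x| ^ (-δ)) volume (-1) 0 := by
    have := (IntervalIntegrable.iff_comp_neg (by simp)).1 hp
    simpa using this.symm
  rw [integrableOn_Icc_iff_integrableOn_Ioc,
    ← intervalIntegrable_iff_integrableOn_Ioc_of_le (by norm_num)]
  exact hn.trans hp

theorem continuous_inv_abs_add {ε : ℝ} (hε : 0 < ε) : Continuous fun x : ℝ => (|x| + ε)⁻¹ :=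
  (continuous_abs.add continuous_const).inv₀ fun x =>
    (add_pos_of_nonneg_of_pos (abs_nonneg x) hε).ne'

theorem integral_inv_abs_add {ε M : ℝ} (hε : 0 < ε) (hM : 0 ≤ M) :
    ∫ x in (-M)..M, (|x| + ε)⁻¹ = 2 * Real.log ((M + ε) / ε) := by
  have hi := fun a b => (continuous_inv_abs_add hε).intervalIntegrable (μ := volume) a b
  have hpos : ∫ x in (0 : ℝ)..M, (|x| + ε)⁻¹ = Real.log ((M + ε) / ε) := by
    have : ∫ x in (0 : ℝ)..M, (|x| + ε)⁻¹ = ∫ x in (0 : ℝ)..M, (x + ε)⁻¹ := by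
      refine intervalIntegral.integral_congr fun x hx => ?_
      rw [Set.uIcc_of_le hM] at hx
      simp only [abs_of_nonneg hx.1]
    rw [this, intervalIntegral.integral_comp_add_right (fun x => x⁻¹), zero_add,
      integral_inv_of_pos hε (by linarith)]
  have hneg : ∫ x in (-M)..0, (|x| + ε)⁻¹ = ∫ x in (0 : ℝ)..M, (|x| + ε)⁻¹ := by
    have := intervalIntegral.integral_comp_neg (a := 0) (b := M) (fun x : ℝ => (|x| + ε)⁻¹)
    simpa using this.symm
  rw [← intervalIntegral.integral_add_adjacent_intervals (hi _ 0) (hi 0 _), hneg, hpos]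
  ring

/-- Translation by `c * a`, of modulus at most `2`, keeps the interval inside `[-3, 3]`, so the
bound is uniform in `a`. -/
theorem setIntegral_inv_abs_add_le {ε c a : ℝ} (hε : 0 < ε) (hc : |c| ≤ 2)
    (ha : a ∈ Set.Icc (-1 : ℝ) 1) :
    ∫ b in Set.Icc (-1 : ℝ) 1, (|b + c * a| + ε)⁻¹ ≤ 2 * Real.log ((3 + ε) / ε) := by
  have hca : |c * a| ≤ 2 := by
    rw [abs_mul]
    have := abs_le.2 ha
    nlinarith [abs_nonneg c, abs_nonneg a]
  have hca' := abs_le.1 hca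
  rw [integral_Icc_eq_integral_Ioc, ← intervalIntegral.integral_of_le (by norm_num),
    intervalIntegral.integral_comp_add_right (fun x => (|x| + ε)⁻¹),
    ← integral_inv_abs_add hε (by norm_num)]
  refine intervalIntegral.integral_mono_interval (by linarith) (by linarith) (by linarith)
    (Filter.Eventually.of_forall fun x => ?_) ((continuous_inv_abs_add hε).intervalIntegrable _ _)
  have := abs_nonneg x
  simp only [Pi.zero_apply]
  positivity

theorem integrable_abs_rpow_mul_inv {δ ε : ℝ} (h1 : δ < 1) (hε : 0 < ε) (c : ℝ) :
    Integrable (fun p : ℝ × ℝ => |p.1| ^ (-δ) * (|p.2 + c * p.1| + ε)⁻¹)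
      ((volume.restrict (Set.Icc (-1 : ℝ) 1)).prod (volume.restrict (Set.Icc (-1 : ℝ) 1))) := by
  have hJ : Integrable (fun p : ℝ × ℝ => |p.1| ^ (-δ) * (1 : ℝ))
      ((volume.restrict (Set.Icc (-1 : ℝ) 1)).prod (volume.restrict (Set.Icc (-1 : ℝ) 1))) :=
    Integrable.mul_prod (integrableOn_abs_rpow_neg h1) (integrable_const 1)
  simp only [mul_one] at hJ
  have hcont : Continuous fun p : ℝ × ℝ => (|p.2 + c * p.1| + ε)⁻¹ :=
    (continuous_inv_abs_add hε).comp
      (show Continuous fun p : ℝ × ℝ => p.2 + c * p.1 by fun_prop)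
  refine hJ.mul_bdd (c := ε⁻¹) hcont.aestronglyMeasurable (Filter.Eventually.of_forall fun p => ?_)
  have := abs_nonneg (p.2 + c * p.1)
  rw [Real.norm_of_nonneg (by positivity)]
  gcongr
  linarith

theorem integral_abs_rpow_mul_inv_le {δ ε c : ℝ} (h1 : δ < 1) (hε : 0 < ε) (hc : |c| ≤ 2) :
    ∫ p : ℝ × ℝ, |p.1| ^ (-δ) * (|p.2 + c * p.1| + ε)⁻¹
      ∂((volume.restrict (Set.Icc (-1 : ℝ) 1)).prod (volume.restrict (Set.Icc (-1 : ℝ) 1))) ≤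
    (∫ a in Set.Icc (-1 : ℝ) 1, |a| ^ (-δ)) * (2 * Real.log ((3 + ε) / ε)) := by
  have hint := integrable_abs_rpow_mul_inv h1 hε c
  rw [integral_prod _ hint, ← integral_mul_const]
  refine setIntegral_mono_on hint.integral_prod_left
    ((integrableOn_abs_rpow_neg h1).mul_const _) measurableSet_Icc fun a ha => ?_
  simp only
  rw [integral_const_mul]
  exact mul_le_mul_of_nonneg_left (setIntegral_inv_abs_add_le hε hc ha) (by positivity)

theorem ae_linear_ne_zero {α β : ℝ} (h : α ≠ 0 ∨ β ≠ 0) :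
    ∀ᵐ p : ℝ × ℝ, α * p.1 + β * p.2 ≠ 0 := by
  let f : ℝ × ℝ →ₗ[ℝ] ℝ := α • LinearMap.fst ℝ ℝ ℝ + β • LinearMap.snd ℝ ℝ ℝ
  have hf : LinearMap.ker f ≠ ⊤ := by
    intro htop
    have hz : f = 0 := LinearMap.ker_eq_top.1 htop
    have e1 : f (1, 0) = 0 := by rw [hz]; rfl
    have e2 : f (0, 1) = 0 := by rw [hz]; rfl
    simp [f] at e1 e2
    rcases h with h | h
    · exact h e1
    · exact h e2
  have := Measure.addHaar_submodule (volume : Measure (ℝ × ℝ)) (LinearMap.ker f) hf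
  rw [ae_iff]
  convert this using 2
  ext p
  simp [f]

theorem continuous_homog : Continuous homog := by
  unfold homog
  refine continuous_pi fun i => ?_
  fin_cases i <;> simp <;> fun_prop

theorem continuous_hexNorm : Continuous hexNorm := by
  unfold hexNorm
  fun_prop

theorem continuous_cesaroKernel (δ : ℝ) (n : ℕ) : Continuous (cesaroKernel δ n) := by
  unfold cesaroKernel dirichletKernel phi
  fun_prop

theorem measurableSet_Omega : MeasurableSet Omega := by
  have h : ∀ i : Fin 3, Measurable fun t : Fin 3 → ℝ => t i := fun i => measurable_pi_apply i
  unfold Omega plane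
  refine MeasurableSet.inter (measurableSet_eq_fun (by fun_prop) (by fun_prop)) ?_
  have strip : ∀ f : (Fin 3 → ℝ) → ℝ, Measurable f → MeasurableSet {t | -1 ≤ f t ∧ f t < 1} :=
    fun f hf => (measurableSet_le measurable_const hf).inter (measurableSet_lt hf measurable_const)
  exact (strip _ (h 0)).inter ((strip _ (h 1)).inter (strip _ (h 2).neg))

theorem homog_preimage_Omega_subset :
    homog ⁻¹' Omega ⊆ Set.Icc (-1 : ℝ) 1 ×ˢ Set.Icc (-1 : ℝ) 1 := by
  rintro ⟨a, b⟩ ⟨-, ⟨h1, h2⟩, ⟨h3, h4⟩, -⟩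
  simp only [homog, Matrix.cons_val_zero, Matrix.cons_val_one] at h1 h2 h3 h4
  exact ⟨⟨h1, h2.le⟩, ⟨h3, h4.le⟩⟩

theorem integrableOn_hexNorm_mul_norm_cesaroKernel (δ : ℝ) (n : ℕ) :
    IntegrableOn (fun p => hexNorm (homog p) * ‖cesaroKernel δ n (homog p)‖)
      (homog ⁻¹' Omega) := by
  have hc : Continuous fun p => hexNorm (homog p) * ‖cesaroKernel δ n (homog p)‖ :=
    (continuous_hexNorm.comp continuous_homog).mul
      ((continuous_cesaroKernel δ n).comp continuous_homog).norm
  exact (hc.continuousOn.integrableOn_compact (isCompact_Icc.prod isCompact_Icc)).mono_set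
    homog_preimage_Omega_subset

/-- The quotient is `3n + 4 ≤ (n+1)^4`. At `n = 0` the right side would vanish, hence `1 ≤ n`. -/
theorem log_three_add_inv_le {n : ℕ} (hn : 1 ≤ n) :
    Real.log ((3 + 1 / ((n : ℝ) + 1)) / (1 / ((n : ℝ) + 1))) ≤ 4 * Real.log ((n : ℝ) + 1) := by
  have hn' : (1 : ℝ) ≤ n := by exact_mod_cast hn
  have e : (3 + 1 / ((n : ℝ) + 1)) / (1 / ((n : ℝ) + 1)) = 3 * n + 4 := by field_simp; ring
  have e4 : (4 : ℝ) * Real.log ((n : ℝ) + 1) = Real.log (((n : ℝ) + 1) ^ 4) := by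
    rw [Real.log_pow]; norm_num
  rw [e, e4]
  refine Real.log_le_log (by positivity) ?_
  have h2 : 3 * (n : ℝ) + 4 ≤ 4 * ((n : ℝ) + 1) ^ 2 := by nlinarith
  nlinarith [sq_nonneg (((n : ℝ) + 1) ^ 2 - 4), mul_self_nonneg ((n : ℝ) - 1),
    (by nlinarith : (4 : ℝ) ≤ ((n : ℝ) + 1) ^ 2)]

end HexFourier

/-! ### The weighted integral of the kernel -/

open HexFourier MeasureTheory in
theorem theorem3 (δ : ℝ) (hδ0 : 0 < δ) (hδ1 : δ < 1) :
    ∃ C : ℝ, 0 < C ∧ ∀ n : ℕ, 1 ≤ n →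
      MeasureTheory.IntegrableOn
        (fun t => HexFourier.hexNorm t * ‖HexFourier.cesaroKernel δ n t‖)
        HexFourier.Omega HexFourier.planeMeasure ∧
      ∫ t in HexFourier.Omega,
          HexFourier.hexNorm t * ‖HexFourier.cesaroKernel δ n t‖ ∂HexFourier.planeMeasure
        ≤ C * (Real.log ((n : ℝ) + 1) / ((n : ℝ) + 1) ^ δ) := by
  set J := ∫ a in Set.Icc (-1 : ℝ) 1, |a| ^ (-δ) with hJ
  have hJ0 : 0 ≤ J := integral_nonneg fun a => by positivity
  -- `24 = 3 · 2 · 4`: three majorants, two half-lines, and the `4` from comparing logarithms. `J +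
  -- 1` makes positivity immediate.
  refine ⟨51200 * (2 / δ + 1) * (24 * (J + 1)), by positivity, fun n hn => ?_⟩
  have hcont : Continuous fun t => hexNorm t * ‖cesaroKernel δ n t‖ :=
    continuous_hexNorm.mul (continuous_cesaroKernel δ n).norm
  have hint := integrableOn_hexNorm_mul_norm_cesaroKernel δ n
  constructor
  · rw [IntegrableOn, planeMeasure, Measure.restrict_map measurable_homog measurableSet_Omega,
      integrable_map_measure hcont.aestronglyMeasurable measurable_homog.aemeasurable]
    exact hint
  rw [planeMeasure, setIntegral_map measurableSet_Omega hcont.aestronglyMeasurable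
    measurable_homog.aemeasurable]
  set N : ℝ := (n : ℝ) + 1 with hN
  have hN0 : 0 < N := by positivity
  set D := 51200 * (2 / δ + 1) * N ^ (-δ) with hD
  have hD0 : 0 ≤ D := by positivity
  set μ := (volume.restrict (Set.Icc (-1 : ℝ) 1)).prod (volume.restrict (Set.Icc (-1 : ℝ) 1))
    with hμ
  let B1 : ℝ → ℝ × ℝ → ℝ := fun c p => |p.1| ^ (-δ) * (|p.2 + c * p.1| + 1 / N)⁻¹
  -- The majorant singular in the second coordinate is a coordinate swap of the first, and the
  -- square is symmetric.
  let B : ℝ × ℝ → ℝ := fun p => D * (B1 2 p + B1 2 p.swap + B1 (-1) p)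
  have hB1 : ∀ c, Integrable (B1 c) μ := fun c =>
    integrable_abs_rpow_mul_inv hδ1 (one_div_pos.2 hN0) c
  have hB1s : Integrable (fun p => B1 2 p.swap) μ := (hB1 2).swap
  have hBint : Integrable B μ := (((hB1 2).add hB1s).add (hB1 (-1))).const_mul D
  have hBnonneg : ∀ p, 0 ≤ B p := fun p => by
    have : ∀ c q, 0 ≤ B1 c q := fun c q => by positivity
    exact mul_nonneg hD0 (add_nonneg (add_nonneg (this _ _) (this _ _)) (this _ _))
  have hμ' : μ = volume.restrict (Set.Icc (-1 : ℝ) 1 ×ˢ Set.Icc (-1 : ℝ) 1) := by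
    rw [hμ, Measure.prod_restrict, ← Measure.volume_eq_prod]
  have hBint' : IntegrableOn B (Set.Icc (-1 : ℝ) 1 ×ˢ Set.Icc (-1 : ℝ) 1) := by
    rw [IntegrableOn, ← hμ']; exact hBint
  have step1 : ∫ p in homog ⁻¹' Omega, hexNorm (homog p) * ‖cesaroKernel δ n (homog p)‖ ≤
      ∫ p in homog ⁻¹' Omega, B p := by
    refine setIntegral_mono_on_ae hint (hBint'.mono_set homog_preimage_Omega_subset)
      (measurable_homog measurableSet_Omega) ?_
    -- The excluded lines are the zeros of the three sines and of the coordinates raised to `-δ`;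
    -- they are null sets.
    filter_upwards [ae_linear_ne_zero (α := 1) (β := 0) (by norm_num),
      ae_linear_ne_zero (α := 0) (β := 1) (by norm_num),
      ae_linear_ne_zero (α := 1) (β := 2) (by norm_num),
      ae_linear_ne_zero (α := 2) (β := 1) (by norm_num),
      ae_linear_ne_zero (α := 1) (β := -1) (by norm_num)] with p g1 g2 g3 g4 g5 hp
    exact hexNorm_mul_norm_cesaroKernel_le hδ0 hδ1 n hp (by simpa using g1) (by simpa using g2)
      (by simpa using g3) (by simpa using g4) (by simpa [sub_eq_add_neg] using g5)
  have step2 : ∫ p in homog ⁻¹' Omega, B p ≤ ∫ p, B p ∂μ := by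
    rw [hμ']
    exact setIntegral_mono_set hBint' (Filter.Eventually.of_forall hBnonneg)
      homog_preimage_Omega_subset.eventuallyLE
  have hle : ∀ c, |c| ≤ 2 → ∫ p, B1 c p ∂μ ≤ J * (2 * (4 * Real.log N)) := fun c hc => by
    refine (integral_abs_rpow_mul_inv_le hδ1 (one_div_pos.2 hN0) hc).trans ?_
    have := log_three_add_inv_le hn
    gcongr
  have hswap : ∫ p, B1 2 p.swap ∂μ = ∫ p, B1 2 p ∂μ := integral_prod_swap (B1 2)
  have step3 : ∫ p, B p ∂μ ≤ D * (3 * (J * (2 * (4 * Real.log N)))) := by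
    have e : ∫ p, B p ∂μ =
        D * (∫ p, B1 2 p ∂μ + ∫ p, B1 2 p.swap ∂μ + ∫ p, B1 (-1) p ∂μ) := by
      simp only [B]
      rw [integral_const_mul,
        integral_add (f := fun p => B1 2 p + B1 2 p.swap) ((hB1 2).add hB1s) (hB1 (-1)),
        integral_add (hB1 2) hB1s]
    rw [e, hswap]
    refine mul_le_mul_of_nonneg_left ?_ hD0
    linarith [hle 2 (by norm_num), hle (-1) (by norm_num)]
  have hlog : 0 ≤ Real.log N := Real.log_nonneg (by rw [hN]; linarith [n.cast_nonneg (α := ℝ)])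
  refine (step1.trans (step2.trans step3)).trans ?_
  rw [hD, Real.rpow_neg hN0.le]
  calc _ = 51200 * (2 / δ + 1) * (24 * J) * (Real.log N / N ^ δ) := by ring
    _ ≤ _ := by gcongr; linarith
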